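/- Let $H$ be a finite multigraph without loops (parallel edges are allowed) with vertices $v_1,\dots,v_m$, let $a_{ij}$ be the number of edges between $v_i$ and $v_j$, and let $d_i=\sum_j a_{ij}$ be the degree of $v_i$. For each $i$ fix a finite, possibly empty, set $\{s_{i,1}<\dots<s_{i,k_i}\}$ of positive integers (with $k_i=0$ if it is empty). For $n>2\max_{i,j}s_{i,j}$ the circulant foliation $H_n$ over $H$ is the multigraph with vertices $(k,v_i)$, $k\in\mathbb Z/n\mathbb Z$, $1\le i\le m$, in which $(k,v_i)$ and $(k,v_j)$ are joined by $a_{ij}$ edges for every $k$ and all $i\ne j$, and $(k,v_i)$ is joined by one edge to each of the vertices $(k\pm s_{i,j},v_i)$, $1\le j\le k_i$; there are no other edges. Let $f(n)$ be the number of rooted spanning forests of $H_n$, that is, of acyclic subgraphs containing all vertices of $H_n$, together with the choice of one vertex (root) in each connected component (parallel edges are distinguished). For variables $x_1,\dots,x_m$ let $L(H,X)$ be the $m\times m$ matrix with diagonal entries $x_i$ and off-diagonal entries $-a_{ij}$. Let $Q(w)\in\mathbb Z[w]$ be $\det L(H,X)$ for $x_i=2k_i+d_i+1-\sum_{j=1}^{k_i}2T_{s_{i,j}}(w)$,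 where $T_s$ is the Chebyshev polynomial of the first kind, and let $P(z)\in\mathbb Z[z,z^{-1}]$ be $\det L(H,X)$ for $x_i=2k_i+d_i+1-\sum_{j=1}^{k_i}(z^{s_{i,j}}+z^{-s_{i,j}})$. Theorem. As $n\to\infty$, $$f(n)\sim A^n,\qquad A=\exp\Bigl(\int_0^1\log|Q(\cos 2\pi t)|\,dt\Bigr),$$ where the integral converges. Moreover $P(z)=Q\bigl(\tfrac12(z+z^{-1})\bigr)$ for all $z\in\mathbb C\setminus\{0\}$, the Laurent polynomial $P$ has no roots on the unit circle, and $A$ is the Mahler measure of $P$, i.e. $A=\exp\bigl(\int_0^1\log|P(e^{2\pi i t})|\,dt\bigr)$; $A$ is also the Mahler measure of every polynomial of the form $z^kP(z)$, $k\in\mathbb Z$. -/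

import Mathlib

open Filter Asymptotics MeasureTheory
open scoped Graph Polynomial LaurentPolynomial

noncomputable section

namespace Foliation

universe u v

/-- A finite or infinite multigraph is a forest if it has no loops, no parallel edges
(a loop is a cycle of length one, two parallel edges form a cycle of length two), and no cycle
of length at least three. -/
structure IsForest {α : Type u} {β : Type v} (F : Graph α β) : Prop where
  simple : F.Simple
  acyclic : F.toSimpleGraph.IsAcyclic

/-- `(F, R)` is a rooted spanning forest of the multigraph `G`: `F` is a subgraph of `G` that
contains all the vertices of `G` and is a forest, and the set `R` of roots consists of exactly one
vertex from every connected component of `F`. -/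
structure IsRootedSpanningForest {α : Type u} {β : Type v} (G F : Graph α β) (R : Set α) :
    Prop where
  spanning : F ≤s G
  forest : IsForest F
  roots_subset : R ⊆ V(F)
  existsUnique_root : ∀ c : F.toSimpleGraph.ConnectedComponent,
    ∃! r : V(F), (r : α) ∈ R ∧ F.toSimpleGraph.connectedComponentMk r = c

/-- The number of rooted spanning forests of a (finite) multigraph; parallel edges are
distinguished. -/
def numRootedSpanningForests {α : Type u} {β : Type v} (G : Graph α β) : ℕ :=
  {p : Graph α β × Set α | IsRootedSpanningForest G p.1 p.2}.ncard

section

variable {V : Type u} {E : Type v}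

/-- The circulant foliation `H_n` over the multigraph `H`, whose fiber over a vertex `i` is
the circulant graph on `ZMod n` with set of jumps `S i` (the graph with no edges if `S i = ∅`).
The vertices are the pairs `(k, i)`.
The edge `inl (k, e)` is the copy of the edge `e` of `H` in the layer `k`.
The edge `inr (k, i, s)`, with `s ∈ S i`, joins `(k, i)` to `(k + s, i)`. For `n > 2 * s` these
edges are pairwise distinct, and `(k, i)` is joined to exactly `(k + s, i)` and `(k - s, i)`. -/
def circulantFoliation (H : Graph V E) (S : V → Finset ℕ) (n : ℕ) :
    Graph (ZMod n × V) ((ZMod n × E) ⊕ (ZMod n × V × ℕ)) where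
  vertexSet := {x | x.2 ∈ V(H)}
  IsLink
    | .inl (k, e), x, y => x.1 = k ∧ y.1 = k ∧ H.IsLink e x.2 y.2
    | .inr (k, i, s), x, y => i ∈ V(H) ∧ s ∈ S i ∧ s(x, y) = s((k, i), (k + (s : ZMod n), i))
  isLink_symm := by
    rintro (⟨k, e⟩ | ⟨k, i, s⟩) -
    · exact ⟨fun x y ⟨h1, h2, h3⟩ => ⟨h2, h1, h3.symm⟩⟩
    · exact ⟨fun x y ⟨h1, h2, h3⟩ => ⟨h1, h2, by rw [Sym2.eq_swap]; exact h3⟩⟩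
  eq_or_eq_of_isLink_of_isLink := by
    rintro (⟨k, e⟩ | ⟨k, i, s⟩) ⟨x1, x2⟩ ⟨y1, y2⟩ ⟨z1, z2⟩ ⟨w1, w2⟩
    · rintro ⟨h1, h2, h3⟩ ⟨h4, h5, h6⟩
      have := h3.left_eq_or_eq h6
      simp_all
    · rintro ⟨-, -, h3⟩ ⟨-, -, h6⟩
      have h := h3.trans h6.symm
      rw [Sym2.eq_iff] at h
      tauto
  left_mem_of_isLink := by
    rintro (⟨k, e⟩ | ⟨k, i, s⟩) ⟨x1, x2⟩ ⟨y1, y2⟩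
    · rintro ⟨-, -, h⟩
      exact h.left_mem
    · rintro ⟨h1, -, h3⟩
      simp only [Sym2.eq_iff, Prod.mk.injEq] at h3
      rcases h3 with ⟨⟨-, rfl⟩, -⟩ | ⟨⟨-, rfl⟩, -⟩ <;> exact h1

/-- The number of edges of `H` between the vertices `i` and `j`. -/
def edgeMult (H : Graph V E) (i j : V) : ℕ := {e : E | H.IsLink e i j}.ncard

/-- The adjacency matrix of `H`. -/
def adjMatrix (H : Graph V E) (R : Type*) [NatCast R] : Matrix V V R :=
  Matrix.of fun i j => (edgeMult H i j : R)

/-- The degree of the vertex `i` of a loopless multigraph `H`. -/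
def deg [Fintype V] (H : Graph V E) (i : V) : ℕ := ∑ j, edgeMult H i j

/-- The generalized Laplacian matrix `L(H, X)`: the diagonal matrix of the `x i` minus the adjacency
matrix. -/
def generalizedLaplacian [DecidableEq V] {R : Type*} [CommRing R] (H : Graph V E) (x : V → R) :
    Matrix V V R :=
  Matrix.diagonal x - adjMatrix H R

variable [Fintype V] [DecidableEq V]

/-- The integer polynomial `Q(w) = det L(H, W)`, where
`w_i = 2 k_i + d_i + 1 - ∑ j, 2 T_{s_{i,j}}(w)`, with the Chebyshev polynomials `T_s` of the
first kind. -/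
def polyQ (H : Graph V E) (S : V → Finset ℕ) : ℤ[X] :=
  (generalizedLaplacian H fun i =>
    2 * ((S i).card : ℤ[X]) + (deg H i : ℤ[X]) + 1
      - ∑ s ∈ S i, 2 * Polynomial.Chebyshev.T ℤ (s : ℤ)).det

/-- The integer Laurent polynomial `P(z) = det L(H, X)`, where
`x_i = 2 k_i + d_i + 1 - ∑ j, (z ^ s_{i,j} + z ^ (-s_{i,j}))`. -/
def laurentP (H : Graph V E) (S : V → Finset ℕ) : ℤ[T;T⁻¹] :=
  (generalizedLaplacian H fun i =>
    2 * ((S i).card : ℤ[T;T⁻¹]) + (deg H i : ℤ[T;T⁻¹]) + 1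
      - ∑ s ∈ S i, (LaurentPolynomial.T (s : ℤ) + LaurentPolynomial.T (-(s : ℤ)))).det

end

/-- The value `P(z)` of an integer Laurent polynomial at a nonzero complex number. -/
def laurentEval (P : ℤ[T;T⁻¹]) (z : ℂˣ) : ℂ :=
  LaurentPolynomial.eval₂ (Int.castRingHom ℂ) z P

open Classical in
/-- The Mahler measure of an integer Laurent polynomial `P`, namely
`exp (∫ t in 0..1, log |P(exp (2 π i t))|)`, and `0` for `P = 0`. -/
def laurentMahlerMeasure (P : ℤ[T;T⁻¹]) : ℝ :=
  if P = 0 then 0 else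
    Real.exp (∫ t in (0 : ℝ)..1,
      Real.log ‖laurentEval P (Circle.toUnits (Circle.exp (2 * Real.pi * t)))‖)

end Foliation

end

/-! Orient each edge of a rooted forest towards its root: every non-root vertex then selects one
incident edge, and following these pointers always ends at a root. Conversely, any terminating
choice of pointers gives back a rooted forest. Expanding the determinant of 1 + Laplacian
multilinearly along its rows produces one term for each choice of pointers. The term is 1 if the
choice terminates and 0 if it does not, so f(n) = det(1 + Laplacian of H_n)
(`det_generalizedLaplacian_eq_ncard`).

This matrix commutes with the translations of ℤ/n, so the characters of ℤ/n block-diagonalise it,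
and f(n) is the product of P(ζ) over the n-th roots of unity ζ
(`numRootedSpanningForests_circulantFoliation`). Replace P by a genuine polynomial z^m P(z), with
leading coefficient c and roots a. The product then has modulus |c|^n ∏ |a^n - 1|.

The summand 1 makes the symbol strictly diagonally dominant on the unit circle
(`det_symbolMatrix_ne_zero`), so no |a| equals 1 and |a^n - 1| ~ max(1, |a|)^n. By Jensen's formula
|c| ∏ max(1, |a|) is the Mahler measure, which z = e^{iθ} turns into the integral of log |Q(cos θ)|.
-/

namespace Foliation

universe u v

/-! ### Rooted spanning forests as terminating pointer maps -/

variable {α : Type u} {β : Type v}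

/-- `Next p w v` says that the pointer map `p` sends `v` to `w`. -/
def Next (p : α → Option (β × α)) (w v : α) : Prop := ∃ e, p v = some (e, w)

/-- A pointer map of a multigraph selects, for every vertex, either nothing or an edge at that
vertex together with its other end, such that following the pointers always terminates. -/
structure IsPointerMap (G : Graph α β) (p : α → Option (β × α)) : Prop where
  isLink : ∀ ⦃v e w⦄, p v = some (e, w) → G.IsLink e v w
  wf : WellFounded (Next p)

/-- The spanning subgraph formed by the edges selected by `p`. -/
def pointerGraph (G : Graph α β) (p : α → Option (β × α)) : Graph α β :=
  G.restrict {e | ∃ v w, p v = some (e, w)}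

/-- Well-founded recursion along the pointers. Being constant along pointers, `root` is an invariant
of connected components; this is how components are told apart below. -/
lemma exists_root {p : α → Option (β × α)} (wf : WellFounded (Next p)) :
    ∃ root : α → α, (∀ v, p v = none → root v = v) ∧
      (∀ v e w, p v = some (e, w) → root v = root w) ∧ (∀ v, p (root v) = none) := by
  let F : ∀ v, (∀ w, Next p w v → α) → α := fun v ih =>
    match h : p v with
    | none => v
    | some (e, w) => ih w ⟨e, h⟩
  have h1 : ∀ v, p v = none → wf.fix F v = v := by
    intro v hv
    rw [WellFounded.fix_eq]
    simp only [F]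
    split
    · rfl
    · simp_all
  have h2 : ∀ v e w, p v = some (e, w) → wf.fix F v = wf.fix F w := by
    intro v e w hv
    rw [WellFounded.fix_eq]
    simp only [F]
    split
    · simp_all
    · rename_i h
      rw [hv] at h
      cases h
      rfl
  refine ⟨wf.fix F, h1, h2, fun v => ?_⟩
  induction v using wf.induction with
  | _ v ih =>
    rcases hv : p v with - | ⟨e, w⟩
    · rw [h1 v hv, hv]
    · rw [h2 v e w hv]
      exact ih w ⟨e, hv⟩

lemma eq_of_reachable {V γ : Type*} {K : SimpleGraph V} {g : V → γ}
    (hg : ∀ x y, K.Adj x y → g x = g y) {x y : V} (h : K.Reachable x y) : g x = g y := by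
  obtain ⟨w⟩ := h
  induction w with
  | nil => rfl
  | cons h _ ih => exact (hg _ _ h).trans ih

lemma exists_adj_dist_lt {V : Type*} {K : SimpleGraph V} {x y : V} (h : K.Reachable x y)
    (hne : x ≠ y) : ∃ z, K.Adj x z ∧ K.dist z y < K.dist x y := by
  obtain ⟨w, hw⟩ := h.exists_walk_length_eq_dist
  cases w with
  | nil => exact (hne rfl).elim
  | cons hz t =>
    refine ⟨_, hz, ?_⟩
    rw [← hw, SimpleGraph.Walk.length_cons]
    exact Nat.lt_succ_of_le (SimpleGraph.dist_le t)

variable {G : Graph α β} {p q : α → Option (β × α)}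

lemma pointerGraph_isLink (hp : IsPointerMap G p) {e : β} {x y : α} :
    (pointerGraph G p).IsLink e x y ↔ p x = some (e, y) ∨ p y = some (e, x) := by
  constructor
  · rintro ⟨⟨v, w, h⟩, hl⟩
    have := hp.isLink h
    rcases this.eq_and_eq_or_eq_and_eq hl with ⟨rfl, rfl⟩ | ⟨rfl, rfl⟩
    · exact Or.inl h
    · exact Or.inr h
  · rintro (h | h)
    · exact ⟨⟨_, _, h⟩, hp.isLink h⟩
    · exact ⟨⟨_, _, h⟩, (hp.isLink h).symm⟩

lemma not_next_symm (wf : WellFounded (Next p)) {x y : α} (h : Next p x y) : ¬ Next p y x :=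
  fun h' => wf.asymmetric _ _ h h'

/-- A loop or a pair of parallel edges would give a pointer cycle of length one or two. For
acyclicity, every edge is a bridge: erase the pointer v → w, so that v becomes its own root. If w
were still connected to v, its root would also be v, and the pointers from w to v together with v →
w would close a cycle. -/
lemma pointerGraph_isForest (hp : IsPointerMap G p) : IsForest (pointerGraph G p) where
  simple :=
    { not_isLoopAt := by
        intro e x h
        rw [← Graph.isLink_self_iff, pointerGraph_isLink hp, or_self] at h
        exact not_next_symm hp.wf ⟨e, h⟩ ⟨e, h⟩
      eq_of_isLink := by
        intro e f x y h1 h2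
        rw [pointerGraph_isLink hp] at h1 h2
        rcases h1 with h1 | h1 <;> rcases h2 with h2 | h2
        · simp_all
        · exact (not_next_symm hp.wf ⟨e, h1⟩ ⟨f, h2⟩).elim
        · exact (not_next_symm hp.wf ⟨e, h1⟩ ⟨f, h2⟩).elim
        · simp_all }
  acyclic := by
    classical
    have key : ∀ (v w : V(pointerGraph G p)) (e : β), p v = some (e, (w : α)) →
        (pointerGraph G p).toSimpleGraph.IsBridge s(v, w) := by
      intro v w e he
      rw [SimpleGraph.isBridge_iff]
      intro hr
      let q := Function.update p v none
      have hsub : ∀ x y, Next q x y → Next p x y := by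
        rintro x y ⟨e, h⟩
        by_cases hy : y = v
        · subst hy; simp [q] at h
        · exact ⟨e, by simpa [q, hy] using h⟩
      have hq : WellFounded (Next q) := Subrelation.wf (hsub _ _) hp.wf
      obtain ⟨root, h1, h2, -⟩ := exists_root hq
      have hacc : ∀ x, Relation.ReflTransGen (Next p) (root x) x := by
        intro x
        induction x using hq.induction with
        | _ x ih =>
          rcases hx : q x with - | ⟨e, y⟩
          · rw [h1 x hx]
          · rw [h2 x e y hx]
            exact (ih y ⟨e, hx⟩).tail (hsub _ _ ⟨e, hx⟩)
      have hinv : root v = root w := by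
        refine eq_of_reachable (g := fun x : V(pointerGraph G p) => root x) ?_ hr
        have aux : ∀ x y : V(pointerGraph G p), s(x, y) ≠ s(v, w) → ∀ f, p x = some (f, (y : α)) →
            root x = root y := by
          intro x y hxy f hf
          refine h2 x f y ?_
          by_cases hx : (x : α) = v
          · rw [hx, he] at hf
            simp only [Option.some.injEq, Prod.mk.injEq] at hf
            exact (hxy (by rw [Subtype.ext hx, Subtype.ext hf.2])).elim
          · simpa [q, hx] using hf
        intro x y hxy
        rw [SimpleGraph.deleteEdges_adj] at hxy
        obtain ⟨⟨-, f, hf⟩, hne⟩ := hxy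
        rw [pointerGraph_isLink hp] at hf
        rcases hf with hf | hf
        · exact aux x y hne f hf
        · exact (aux y x (by rwa [Sym2.eq_swap]) f hf).symm
      rw [h1 v (by simp [q])] at hinv
      have := hacc w
      rw [← hinv] at this
      have h3 : Relation.TransGen (Next p) v v := Relation.TransGen.tail' this ⟨e, he⟩
      exact hp.wf.transGen.irrefl.irrefl _ h3
    rw [SimpleGraph.isAcyclic_iff_forall_adj_isBridge]
    rintro v w ⟨-, e, he⟩
    rw [pointerGraph_isLink hp] at he
    rcases he with he | he
    · exact key v w e he
    · rw [Sym2.eq_swap]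
      exact key w v e he

lemma pointerGraph_isRootedSpanningForest (hV : V(G) = Set.univ) (hp : IsPointerMap G p) :
    IsRootedSpanningForest G (pointerGraph G p) {v | p v = none} where
  spanning := ⟨Graph.restrict_le, rfl⟩
  forest := pointerGraph_isForest hp
  roots_subset := fun v _ => show v ∈ V(G) from hV ▸ Set.mem_univ v
  existsUnique_root := by
    have hmem : ∀ v, v ∈ V(pointerGraph G p) := fun v => show v ∈ V(G) from hV ▸ Set.mem_univ v
    obtain ⟨root, h1, h2, h3⟩ := exists_root hp.wf
    have hloop := (pointerGraph_isForest hp).simple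
    have hreach : ∀ x, (pointerGraph G p).toSimpleGraph.Reachable ⟨root x, hmem _⟩ ⟨x, hmem x⟩ := by
      intro x
      induction x using hp.wf.induction with
      | _ x ih =>
        rcases hx : p x with - | ⟨e, y⟩
        · simp only [h1 x hx]; rfl
        · simp only [h2 x e y hx]
          refine (ih y ⟨e, hx⟩).trans (SimpleGraph.Adj.reachable ?_)
          rw [Graph.toSimpleGraph_adj_iff]
          exact ⟨e, (pointerGraph_isLink hp).2 (Or.inr hx)⟩
    intro c
    induction c using SimpleGraph.ConnectedComponent.ind with
    | _ v =>
      refine ⟨⟨root v, hmem _⟩, ⟨h3 v, SimpleGraph.ConnectedComponent.eq.2 (hreach v)⟩, ?_⟩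
      rintro ⟨r, hr⟩ ⟨hr1, hr2⟩
      have := eq_of_reachable (g := fun x : V(pointerGraph G p) => root x) ?_
        (SimpleGraph.ConnectedComponent.eq.1 hr2)
      · rw [Subtype.mk.injEq, ← h1 r hr1]
        exact this
      · rintro x y ⟨-, f, hf⟩
        rw [pointerGraph_isLink hp] at hf
        rcases hf with hf | hf
        · exact h2 _ _ _ hf
        · exact (h2 _ _ _ hf).symm

/-- By finiteness the reversed pointer relation is well founded too, so there is a disagreement v at
which no other disagreement points under p. If q sends v to w along e, then e lies in the graph of
p. Since p and q differ at v, p must send w to v along e. But q cannot do so without a 2-cycle, so w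
is a disagreement pointing at v. -/
lemma pointerMap_injOn [Finite α] (hp : IsPointerMap G p) (hq : IsPointerMap G q)
    (hF : pointerGraph G p = pointerGraph G q) (hR : {v | p v = none} = {v | q v = none}) :
    p = q := by
  by_contra hne
  have hex : ({v | p v ≠ q v} : Set α).Nonempty := by
    by_contra h
    rw [Set.not_nonempty_iff_eq_empty, Set.eq_empty_iff_forall_notMem] at h
    exact hne (funext fun v => by simpa using h v)
  have hwf : WellFounded (fun a b => Next p b a) := by
    have hirr : Std.Irrefl (Relation.TransGen (Next p)) := hp.wf.transGen.irrefl
    have : WellFounded (fun a b => Relation.TransGen (Next p) b a) := by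
      have : IsTrans α (fun a b => Relation.TransGen (Next p) b a) :=
        ⟨fun a b c h1 h2 => h2.trans h1⟩
      have : Std.Irrefl (fun a b => Relation.TransGen (Next p) b a) := ⟨fun a h => hirr.irrefl a h⟩
      exact Finite.wellFounded_of_trans_of_irrefl _
    exact Subrelation.wf (fun h => Relation.TransGen.single h) this
  obtain ⟨v, hv, hmin⟩ := hwf.has_min _ hex
  have hR' : ∀ v, p v = none ↔ q v = none := fun v => Set.ext_iff.1 hR v
  rcases hqv : q v with - | ⟨e, w⟩
  · exact hv (by rw [(hR' v).2 hqv, hqv])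
  · have hl : (pointerGraph G p).IsLink e v w := by
      rw [hF, pointerGraph_isLink hq]; exact Or.inl hqv
    rw [pointerGraph_isLink hp] at hl
    rcases hl with hl | hl
    · exact hv (by rw [hl, hqv])
    · refine hmin w ?_ ⟨e, hl⟩
      intro h
      rw [hl] at h
      exact not_next_symm hq.wf ⟨e, hqv⟩ ⟨e, h.symm⟩

/-- Each non-root points to a neighbour strictly closer to the root of its component; the distance
makes the pointers terminate. -/
lemma exists_pointerMap (hV : V(G) = Set.univ) {F : Graph α β} {R : Set α}
    (h : IsRootedSpanningForest G F R) :
    ∃ p, IsPointerMap G p ∧ pointerGraph G p = F ∧ {v | p v = none} = R := by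
  classical
  have hmem : ∀ v, v ∈ V(F) := fun v => by rw [h.spanning.vertexSet_eq, hV]; trivial
  have hsimple := h.forest.simple
  let K := F.toSimpleGraph
  choose rt hrt huniq using fun v => h.existsUnique_root (K.connectedComponentMk ⟨v, hmem v⟩)
  have hreach : ∀ v, K.Reachable ⟨v, hmem v⟩ (rt v) := fun v =>
    (SimpleGraph.ConnectedComponent.eq.1 (hrt v).2).symm
  have hadj : ∀ e v w, F.IsLink e v w → K.Adj ⟨v, hmem v⟩ ⟨w, hmem w⟩ := fun e v w hl =>
    (Graph.toSimpleGraph_adj_iff _ _).2 ⟨e, hl⟩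
  have hrteq : ∀ v w, K.Reachable ⟨v, hmem v⟩ ⟨w, hmem w⟩ → rt v = rt w := fun v w hvw =>
    huniq w (rt v) ⟨(hrt v).1, (hrt v).2.trans (SimpleGraph.ConnectedComponent.eq.2 hvw)⟩
  let d : α → ℕ := fun v => K.dist ⟨v, hmem v⟩ (rt v)
  have hstep : ∀ v, v ∉ R → ∃ x : β × α, F.IsLink x.1 v x.2 ∧ d x.2 < d v := by
    intro v hv
    have hne : (⟨v, hmem v⟩ : V(F)) ≠ rt v := by
      intro h
      apply hv
      have := (hrt v).1
      rw [← h] at this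
      exact this
    obtain ⟨y, hy, hlt⟩ := exists_adj_dist_lt (hreach v) hne
    obtain ⟨e, he⟩ := (Graph.toSimpleGraph_adj_iff _ _).1 hy
    refine ⟨(e, y), he, ?_⟩
    have h1 : rt v = rt y := hrteq v y hy.reachable
    simp only [d, ← h1]
    exact hlt
  choose f hf1 hf2 using hstep
  let p : α → Option (β × α) := fun v => if h : v ∈ R then none else some (f v h)
  have hpsome : ∀ v e w, p v = some (e, w) → F.IsLink e v w ∧ d w < d v := by
    intro v e w hv
    by_cases hvR : v ∈ R
    · simp [p, hvR] at hv
    · simp only [p, hvR, dite_false, Option.some.injEq] at hv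
      have h1 := hf1 v hvR
      have h2 := hf2 v hvR
      rw [hv] at h1 h2
      exact ⟨h1, h2⟩
  have hp : IsPointerMap G p :=
    { isLink := fun v e w hv => (hpsome v e w hv).1.mono h.spanning.le
      wf := Subrelation.wf (r := InvImage (· < ·) d)
        (by rintro w v ⟨e, hv⟩; exact (hpsome v e w hv).2) (InvImage.wf _ wellFounded_lt) }
  have hpR : {v | p v = none} = R := by
    ext v
    by_cases hvR : v ∈ R <;> simp [p, hvR]
  refine ⟨p, hp, Graph.ext h.spanning.vertexSet_eq.symm fun e v w => ⟨?_, fun hl => ?_⟩, hpR⟩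
  · rw [pointerGraph_isLink hp]
    rintro (hl | hl)
    · exact (hpsome _ _ _ hl).1
    · exact (hpsome _ _ _ hl).1.symm
  -- An edge of F that no pointer uses would be a bridge. Yet every vertex reaches its root along
  -- pointer edges, which avoid it, and its two ends share a root.
  · by_contra hnot
    rw [pointerGraph_isLink hp] at hnot
    have hbr := (SimpleGraph.isAcyclic_iff_forall_adj_isBridge.1 h.forest.acyclic) (hadj e v w hl)
    rw [SimpleGraph.isBridge_iff] at hbr
    have hr : ∀ x, (K.deleteEdges {s(⟨v, hmem v⟩, ⟨w, hmem w⟩)}).Reachable ⟨x, hmem x⟩ (rt x) := by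
      intro x
      induction x using hp.wf.induction with
      | _ x ih =>
        rcases hx : p x with - | ⟨e', y⟩
        · have hxR : x ∈ R := by rw [← hpR]; exact hx
          rw [← huniq x ⟨x, hmem x⟩ ⟨hxR, rfl⟩]
        · have hxy := (hpsome _ _ _ hx).1
          rw [hrteq x y (hadj _ _ _ hxy).reachable]
          refine SimpleGraph.Reachable.trans (SimpleGraph.Adj.reachable ?_) (ih y ⟨e', hx⟩)
          rw [SimpleGraph.deleteEdges_adj]
          refine ⟨hadj _ _ _ hxy, ?_⟩
          rw [Set.mem_singleton_iff, Sym2.eq_iff]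
          rintro (⟨h1, h2⟩ | ⟨h1, h2⟩) <;> rw [Subtype.mk.injEq] at h1 h2 <;> subst h1 h2
          · rw [hl.eq hxy] at hnot
            exact hnot (Or.inl hx)
          · rw [hl.eq hxy.symm] at hnot
            exact hnot (Or.inr hx)
    have h1 := hr v
    rw [hrteq v w (hadj _ _ _ hl).reachable] at h1
    exact hbr (h1.trans (hr w).symm)

/-- Rooted spanning forests are in bijection with pointer maps. -/
theorem numRootedSpanningForests_eq_ncard [Finite α] (hV : V(G) = Set.univ) :
    numRootedSpanningForests G = {p | IsPointerMap G p}.ncard := by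
  have himg : {x : Graph α β × Set α | IsRootedSpanningForest G x.1 x.2} =
      (fun p => (pointerGraph G p, {v | p v = none})) '' {p | IsPointerMap G p} := by
    ext ⟨F, R⟩
    constructor
    · intro h
      obtain ⟨p, hp, h1, h2⟩ := exists_pointerMap hV h
      exact ⟨p, hp, by simp [h1, h2]⟩
    · rintro ⟨p, hp, h⟩
      simp only [Prod.mk.injEq] at h
      rw [← h.1, ← h.2]
      exact pointerGraph_isRootedSpanningForest hV hp
  rw [numRootedSpanningForests, himg]
  refine Set.InjOn.ncard_image ?_
  intro p hp q hq h
  simp only [Prod.mk.injEq] at h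
  exact pointerMap_injOn hp hq h.1 h.2

end Foliation

/-! ### The matrix forest theorem -/

namespace Foliation

universe u v

variable {α : Type u} {β : Type v}

/-- The row at `v` of the matrix `1 - N`, where `N` has an entry `1` at the target of the
pointer `o` of `v`. -/
def pointerRow [DecidableEq α] (v : α) : Option (β × α) → α → ℤ
  | none => Pi.single v 1
  | some x => Pi.single v 1 - Pi.single x.2 1

variable [Fintype α] [DecidableEq α]

/-- Pointers strictly lower the rank of the well-founded relation, so ordering vertices by rank
makes the matrix block triangular with identity diagonal blocks. -/
lemma det_pointerRow_of_wf {p : α → Option (β × α)} (wf : WellFounded (Next p)) :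
    (Matrix.of fun v => pointerRow v (p v)).det = 1 := by
  classical
  have hwf : IsWellFounded α (Next p) := ⟨wf⟩
  let h : α → Ordinal := IsWellFounded.rank (Next p)
  have hlt : ∀ v x, p v = some x → h x.2 < h v := fun v x hx =>
    IsWellFounded.rank_lt_of_rel ⟨x.1, hx⟩
  have hentry : ∀ v w, h v ≤ h w → pointerRow v (p v) w = if v = w then 1 else 0 := by
    intro v w hvw
    rcases hv : p v with - | x
    · simp [pointerRow, Pi.single_apply, eq_comm]
    · have : w ≠ x.2 := by
        rintro rfl
        exact absurd (hlt v x hv) (not_lt.2 hvw)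
      simp [pointerRow, Pi.single_apply, this, eq_comm]
  have hM : (Matrix.of fun v => pointerRow v (p v)).BlockTriangular (OrderDual.toDual ∘ h) := by
    intro v w hvw
    have hvw' : h v < h w := hvw
    rw [Matrix.of_apply, hentry v w hvw'.le, if_neg]
    rintro rfl
    exact lt_irrefl _ hvw'
  rw [hM.det]
  refine Finset.prod_eq_one fun a _ => ?_
  suffices hone : (Matrix.of fun v => pointerRow v (p v)).toSquareBlock (OrderDual.toDual ∘ h) a
      = 1 by rw [hone, Matrix.det_one]
  ext ⟨v, hv⟩ ⟨w, hw⟩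
  have hvw : h v = h w := OrderDual.toDual.injective (hv.trans hw.symm)
  simp [Matrix.toSquareBlock_def, hentry v w hvw.le, Matrix.one_apply]

/-- The indicator of the non-accessible vertices is a nonzero kernel vector: a vertex is accessible
exactly when its target is, and vertices without pointer are accessible. -/
lemma det_pointerRow_of_not_wf {p : α → Option (β × α)} (wf : ¬ WellFounded (Next p)) :
    (Matrix.of fun v => pointerRow v (p v)).det = 0 := by
  classical
  rw [← Matrix.exists_mulVec_eq_zero_iff]
  refine ⟨fun v => if Acc (Next p) v then 0 else 1, ?_, ?_⟩
  · intro h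
    refine wf ⟨fun v => ?_⟩
    by_contra hv
    simpa [hv] using congrFun h v
  · ext v
    rcases hv : p v with - | ⟨e, w⟩
    · have : Acc (Next p) v := ⟨v, fun y ⟨e, hy⟩ => by simp [hv] at hy⟩
      simp [Matrix.mulVec, hv, pointerRow, this]
    · have : Acc (Next p) v ↔ Acc (Next p) w := by
        refine ⟨fun h => h.inv ⟨e, hv⟩, fun h => ⟨v, ?_⟩⟩
        rintro y ⟨f, hy⟩
        rw [hv] at hy
        cases hy
        exact h
      change pointerRow v (p v) ⬝ᵥ _ = 0
      rw [hv]
      change (Pi.single v 1 - Pi.single w 1) ⬝ᵥ _ = 0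
      simp [sub_dotProduct, this]

/-- The matrix forest theorem, for pointer maps. -/
theorem det_generalizedLaplacian_eq_ncard (G : Graph α β) (hE : E(G).Finite) :
    (generalizedLaplacian G (fun v => (deg G v : ℤ) + 1)).det =
      ({p | IsPointerMap G p}.ncard : ℤ) := by
  classical
  have hfin : ∀ v w, {e | G.IsLink e v w}.Finite := fun v w =>
    hE.subset fun e he => Graph.IsLink.edge_mem he
  have hfin' : ∀ v, {x : β × α | G.IsLink x.1 v x.2}.Finite := fun v =>
    (hE.prod (Set.finite_univ (α := α))).subset fun x hx => ⟨Graph.IsLink.edge_mem hx, trivial⟩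
  let N : α → Finset (Option (β × α)) := fun v => Finset.insertNone (hfin' v).toFinset
  have hsum : ∀ (v : α) (g : α → ℤ),
      ∑ x ∈ (hfin' v).toFinset, g x.2 = ∑ u, (edgeMult G v u : ℤ) * g u := by
    intro v g
    have : (hfin' v).toFinset = Finset.univ.biUnion fun u =>
        (hfin v u).toFinset.map (Function.Embedding.sectL β u) := by
      ext ⟨e, u⟩
      simp
    rw [this, Finset.sum_biUnion]
    · refine Finset.sum_congr rfl fun u _ => ?_
      rw [Finset.sum_map]
      simp only [Function.Embedding.sectL_apply, Finset.sum_const, nsmul_eq_mul]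
      rw [edgeMult, Set.ncard_eq_toFinset_card _ (hfin v u)]
    · intro u _ u' _ hne
      rw [Function.onFun, Finset.disjoint_left]
      intro x hx hx'
      simp only [Finset.mem_map, Function.Embedding.sectL_apply] at hx hx'
      obtain ⟨e, -, rfl⟩ := hx
      obtain ⟨e', -, h⟩ := hx'
      exact hne (Prod.ext_iff.1 h).2.symm
  -- The choice `none` accounts for the summand 1 on the diagonal; each edge from v to u contributes
  -- e_v - e_u.
  have hrow : generalizedLaplacian G (fun v => (deg G v : ℤ) + 1) =
      Matrix.of fun v => ∑ o ∈ N v, pointerRow v o := by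
    ext v w
    rw [Matrix.of_apply, Finset.sum_apply]
    simp only [N, Finset.sum_insertNone]
    have h1 : ∑ x ∈ (hfin' v).toFinset, pointerRow v (some x) w =
        ∑ u, (edgeMult G v u : ℤ) * (Pi.single v 1 - Pi.single u 1 : α → ℤ) w :=
      hsum v (fun u => (Pi.single v 1 - Pi.single u 1 : α → ℤ) w)
    rw [h1]
    simp only [Pi.sub_apply, mul_sub, Finset.sum_sub_distrib, ← Finset.sum_mul, Pi.single_apply,
      pointerRow, generalizedLaplacian, adjMatrix, Matrix.sub_apply, Matrix.of_apply,
      Matrix.diagonal_apply, deg]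
    rcases eq_or_ne v w with rfl | hvw
    · simp
      ring
    · simp [hvw, hvw.symm]
  have hexp : (generalizedLaplacian G (fun v => (deg G v : ℤ) + 1)).det =
      ∑ p ∈ Fintype.piFinset N, (Matrix.of fun v => pointerRow v (p v)).det := by
    rw [hrow]
    exact (Matrix.detRowAlternating (n := α) (R := ℤ)).toMultilinearMap.map_sum_finset
      (fun v o => pointerRow v o) N
  have hdet : ∀ p : α → Option (β × α), (Matrix.of fun v => pointerRow v (p v)).det =
      if WellFounded (Next p) then 1 else 0 := by
    intro p
    split_ifs with h
    · exact det_pointerRow_of_wf h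
    · exact det_pointerRow_of_not_wf h
  rw [hexp]
  simp_rw [hdet]
  rw [← Finset.sum_filter, Finset.sum_const, nsmul_eq_mul, mul_one, ← Set.ncard_coe_finset]
  congr 2
  ext p
  simp only [Finset.coe_filter, Fintype.mem_piFinset, Set.mem_ofPred_eq, N,
    Finset.mem_insertNone, Set.Finite.mem_toFinset, Option.mem_def, Prod.forall]
  exact ⟨fun h => ⟨fun v e w hv => h.1 v e w hv, h.2⟩, fun h => ⟨fun v e w hv => h.1 hv, h.2⟩⟩

end Foliation

/-! ### The Laplacian of the foliation -/

namespace Foliation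

universe u v

section

variable {V : Type u} {E : Type v}

lemma map_det_generalizedLaplacian [Fintype V] [DecidableEq V] {R R' : Type*} [CommRing R]
    [CommRing R'] (f : R →+* R') (H : Graph V E) (x : V → R) :
    f (generalizedLaplacian H x).det = (generalizedLaplacian H fun i => f (x i)).det := by
  rw [RingHom.map_det]
  congr 1
  ext i j
  simp only [generalizedLaplacian, adjMatrix, RingHom.mapMatrix_apply, Matrix.map_apply,
    Matrix.sub_apply, Matrix.diagonal_apply, Matrix.of_apply, map_sub, map_natCast]
  split_ifs <;> simp

/-- The generalized Laplacian matrix whose determinant is `P(z)`. -/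
noncomputable def symbolMatrix [Fintype V] [DecidableEq V] (H : Graph V E) (S : V → Finset ℕ)
    (z : ℂ) : Matrix V V ℂ :=
  generalizedLaplacian H fun i =>
    2 * ((S i).card : ℂ) + (deg H i : ℂ) + 1 - ∑ s ∈ S i, (z ^ s + z⁻¹ ^ s)

lemma laurentEval_laurentP [Fintype V] [DecidableEq V] (H : Graph V E) (S : V → Finset ℕ)
    (z : ℂˣ) : laurentEval (laurentP H S) z = (symbolMatrix H S z).det := by
  rw [laurentEval, laurentP, map_det_generalizedLaplacian, symbolMatrix]
  congr 2
  ext i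
  have h2 : LaurentPolynomial.eval₂ (Int.castRingHom ℂ) z 2 = 2 := map_ofNat _ 2
  simp [LaurentPolynomial.eval₂_T, h2]

variable {H : Graph V E} {S : V → Finset ℕ} {n : ℕ}

lemma circulantFoliation_edgeSet_finite [Finite V] [NeZero n] (hE : E(H).Finite) :
    E(circulantFoliation H S n).Finite := by
  have h1 : (Sum.inl '' ((Set.univ : Set (ZMod n)) ×ˢ E(H)) ∪
      Sum.inr '' ((Set.univ : Set (ZMod n)) ×ˢ
        ⋃ i, (Prod.mk i) '' (S i : Set ℕ)) : Set ((ZMod n × E) ⊕ (ZMod n × V × ℕ))).Finite := by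
    refine Set.Finite.union (Set.Finite.image _ (Set.finite_univ.prod hE))
      (Set.Finite.image _ (Set.finite_univ.prod ?_))
    exact Set.finite_iUnion fun i => Set.Finite.image _ (S i).finite_toSet
  refine h1.subset ?_
  rintro (⟨k, e⟩ | ⟨k, i, s⟩) h
  · obtain ⟨x, y, -, -, hl⟩ := Graph.exists_isLink_of_mem_edgeSet h
    exact Or.inl ⟨(k, e), ⟨trivial, hl.edge_mem⟩, rfl⟩
  · obtain ⟨x, y, -, hs, -⟩ := Graph.exists_isLink_of_mem_edgeSet h
    exact Or.inr ⟨(k, i, s), ⟨trivial, Set.mem_iUnion.2 ⟨i, s, hs, rfl⟩⟩, rfl⟩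

/-- An edge inside a fiber is based either at k or at l. The two families are disjoint because a
common label forces k = l and hence s = 0 in `ZMod n`. Nothing more is needed of n: jumps that agree
up to sign modulo n still carry different labels and are counted separately on both sides. -/
lemma edgeMult_circulantFoliation [DecidableEq V] (hV : V(H) = Set.univ) (hE : E(H).Finite)
    (hS : ∀ i, ∀ s ∈ S i, (s : ZMod n) ≠ 0) (k l : ZMod n) (i j : V) :
    edgeMult (circulantFoliation H S n) (k, i) (l, j) =
      (if k = l then edgeMult H i j else 0) +
      if i = j then ∑ s ∈ S i, ((if l = k + s then 1 else 0) + if l = k - s then 1 else 0)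
      else 0 := by
  classical
  have hsplit : {e | (circulantFoliation H S n).IsLink e (k, i) (l, j)} =
      Sum.inl '' {x : ZMod n × E | k = x.1 ∧ l = x.1 ∧ H.IsLink x.2 i j} ∪
      Sum.inr '' {x : ZMod n × V × ℕ | x.2.2 ∈ S x.2.1 ∧
        s((k, i), (l, j)) = s((x.1, x.2.1), (x.1 + (x.2.2 : ZMod n), x.2.1))} := by
    ext (⟨k', e⟩ | ⟨k', i', s⟩)
    · simp [circulantFoliation]
    · simp [circulantFoliation, hV]
  have h1 : {x : ZMod n × E | k = x.1 ∧ l = x.1 ∧ H.IsLink x.2 i j} =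
      if k = l then Prod.mk k '' {e | H.IsLink e i j} else ∅ := by
    ext ⟨k', e⟩
    split_ifs with h
    · subst h
      simp only [Set.mem_ofPred_eq, Set.mem_image, Prod.mk.injEq]
      constructor
      · rintro ⟨rfl, -, h⟩
        exact ⟨e, h, rfl, rfl⟩
      · rintro ⟨e', h, rfl, rfl⟩
        exact ⟨rfl, rfl, h⟩
    · simp only [Set.mem_ofPred_eq, Set.mem_empty_iff_false, iff_false]
      rintro ⟨rfl, rfl, -⟩
      exact h rfl
  have h2 : {x : ZMod n × V × ℕ | x.2.2 ∈ S x.2.1 ∧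
        s((k, i), (l, j)) = s((x.1, x.2.1), (x.1 + (x.2.2 : ZMod n), x.2.1))} =
      if i = j then
        ((((S i).filter fun s : ℕ => l = k + s).image (fun s => (k, i, s)) ∪
          ((S i).filter fun s : ℕ => l = k - s).image (fun s => (l, i, s)) :
          Finset (ZMod n × V × ℕ)) : Set (ZMod n × V × ℕ))
      else ∅ := by
    ext ⟨k', i', s⟩
    split_ifs with h
    · subst h
      simp only [Set.mem_ofPred_eq, Sym2.eq_iff, Prod.mk.injEq, Finset.coe_union,
        Finset.coe_image, Finset.coe_filter, Set.mem_union, Set.mem_image]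
      constructor
      · rintro ⟨hs, ⟨⟨rfl, rfl⟩, h, -⟩ | ⟨⟨h, rfl⟩, rfl, -⟩⟩
        · exact Or.inl ⟨s, ⟨hs, h⟩, rfl, rfl, rfl⟩
        · exact Or.inr ⟨s, ⟨hs, by rw [h]; ring⟩, rfl, rfl, rfl⟩
      · rintro (⟨s, ⟨hs, h⟩, rfl, rfl, rfl⟩ | ⟨s, ⟨hs, h⟩, rfl, rfl, rfl⟩)
        · exact ⟨hs, Or.inl ⟨⟨rfl, rfl⟩, h, rfl⟩⟩
        · exact ⟨hs, Or.inr ⟨⟨by rw [h]; ring, rfl⟩, rfl, rfl⟩⟩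
    · simp only [Set.mem_ofPred_eq, Sym2.eq_iff, Prod.mk.injEq, Set.mem_empty_iff_false, iff_false]
      rintro ⟨-, ⟨⟨-, rfl⟩, -, rfl⟩ | ⟨⟨-, rfl⟩, -, rfl⟩⟩ <;> exact h rfl
  have hfin : {e | H.IsLink e i j}.Finite := hE.subset fun e he => Graph.IsLink.edge_mem he
  rw [edgeMult, hsplit, Set.ncard_union_eq ?_ ?_ ?_, Set.ncard_image_of_injective _ Sum.inl_injective,
    Set.ncard_image_of_injective _ Sum.inr_injective, h1, h2]
  · congr 1
    · split_ifs
      · rw [Set.ncard_image_of_injective _ (Prod.mk_right_injective k)]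
        rfl
      · simp
    · split_ifs with h
      · rw [Set.ncard_coe_finset, Finset.card_union_of_disjoint,
          Finset.card_image_of_injective, Finset.card_image_of_injective,
          Finset.sum_add_distrib, Finset.card_filter, Finset.card_filter]
        · intro a b hab
          simpa using hab
        · intro a b hab
          simpa using hab
        · rw [Finset.disjoint_left]
          intro x hx hx'
          simp only [Finset.mem_image, Finset.mem_filter] at hx hx'
          obtain ⟨s, ⟨hs, hs'⟩, rfl⟩ := hx
          obtain ⟨t, -, ht⟩ := hx'
          simp only [Prod.mk.injEq] at ht
          apply hS i s hs
          rw [ht.1] at hs'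
          simpa using hs'
      · simp
  · rw [Set.disjoint_left]
    rintro _ ⟨x, -, rfl⟩ ⟨y, -, hy⟩
    cases hy
  · rw [h1]
    split_ifs
    · exact (hfin.image _).image _
    · simp
  · rw [h2]
    split_ifs
    · exact (Finset.finite_toSet _).image _
    · simp

lemma deg_circulantFoliation [Fintype V] [DecidableEq V] [NeZero n] (hV : V(H) = Set.univ)
    (hE : E(H).Finite) (hS : ∀ i, ∀ s ∈ S i, (s : ZMod n) ≠ 0) (k : ZMod n) (i : V) :
    deg (circulantFoliation H S n) (k, i) = deg H i + 2 * (S i).card := by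
  rw [deg, Fintype.sum_prod_type]
  simp_rw [edgeMult_circulantFoliation hV hE hS, Finset.sum_add_distrib]
  congr 1
  · simp [deg]
  · simp only [Finset.sum_ite_eq, Finset.mem_univ, if_true, Finset.sum_add_distrib]
    rw [Finset.sum_comm, Finset.sum_comm (s := Finset.univ) (t := S i)]
    simp [two_mul]

end

/-! ### Block diagonalisation by characters of ℤ/n -/

section Fourier

variable {n : ℕ} [NeZero n]

/-- Orthogonality of characters: the Fourier matrix times its conjugate is n times the identity. -/
lemma det_stdAddChar_mul_ne_zero :
    (Matrix.of fun k l : ZMod n => ZMod.stdAddChar (k * l)).det ≠ 0 := by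
  have h : (Matrix.of fun k l : ZMod n => ZMod.stdAddChar (k * l)) *
      (Matrix.of fun k l : ZMod n => ZMod.stdAddChar (-(k * l))) = (n : ℂ) • 1 := by
    ext k l
    simp only [Matrix.mul_apply, Matrix.of_apply, ← AddChar.map_add_eq_mul]
    have := AddChar.sum_mulShift (k - l) (ZMod.isPrimitive_stdAddChar n)
    simp only [ZMod.card, sub_eq_zero, Nat.cast_ite, Nat.cast_zero] at this
    simp only [Matrix.smul_apply, Matrix.one_apply, smul_eq_mul, mul_ite, mul_one, mul_zero]
    rw [← this]
    refine Finset.sum_congr rfl fun m _ => ?_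
    congr 1
    ring
  intro h0
  have := congrArg Matrix.det h
  rw [Matrix.det_mul, h0, zero_mul, Matrix.det_smul, Matrix.det_one, mul_one] at this
  exact pow_ne_zero _ (Nat.cast_ne_zero.2 (NeZero.ne n)) this.symm

variable {V : Type u} {E : Type v} [Fintype V] [DecidableEq V] {H : Graph V E} {S : V → Finset ℕ}

/-- On vectors χ_l ⊗ u, with χ_l the l-th character, a shift by ±s acts as multiplication by ζ^{±s},
where ζ = χ_l(1). Hence 1 + Laplacian acts on u as the symbol at ζ. The Fourier matrix Φ collects
these vectors and is invertible, so it cancels from the determinants. -/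
theorem numRootedSpanningForests_circulantFoliation (hV : V(H) = Set.univ) (hE : E(H).Finite)
    (hS : ∀ i, ∀ s ∈ S i, (s : ZMod n) ≠ 0) :
    (numRootedSpanningForests (circulantFoliation H S n) : ℂ) =
      ∏ l : ZMod n, (symbolMatrix H S (ZMod.stdAddChar l)).det := by
  set G := circulantFoliation H S n
  have hGV : V(G) = Set.univ := by
    ext x
    simp [G, circulantFoliation, hV]
  have hM : (numRootedSpanningForests G : ℂ) =
      (generalizedLaplacian G fun v => (deg G v : ℂ) + 1).det := by
    have h := det_generalizedLaplacian_eq_ncard G (circulantFoliation_edgeSet_finite hE)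
    rw [← numRootedSpanningForests_eq_ncard hGV] at h
    have h' := congrArg (Int.castRingHom ℂ) h
    rw [map_det_generalizedLaplacian] at h'
    simpa using h'.symm
  let Φ : Matrix (ZMod n × V) (ZMod n × V) ℂ :=
    Matrix.kronecker (Matrix.of fun k l : ZMod n => ZMod.stdAddChar (k * l)) 1
  let D : Matrix (ZMod n × V) (ZMod n × V) ℂ :=
    -- `Matrix.blockDiagonal` puts the block index second, hence the swap.
    (Matrix.blockDiagonal fun l => symbolMatrix H S (ZMod.stdAddChar l)).submatrix
      (Equiv.prodComm _ _) (Equiv.prodComm _ _)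
  have hΦ : Φ.det ≠ 0 := by
    simp only [Φ, Matrix.kronecker]
    rw [Matrix.det_kronecker, Matrix.det_one, one_pow, mul_one]
    exact pow_ne_zero _ det_stdAddChar_mul_ne_zero
  have hD : D.det = ∏ l : ZMod n, (symbolMatrix H S (ZMod.stdAddChar l)).det := by
    rw [Matrix.det_submatrix_equiv_self, Matrix.det_blockDiagonal]
  have hcomm : (generalizedLaplacian G fun v => (deg G v : ℂ) + 1) * Φ = Φ * D := by
    ext ⟨k, i⟩ ⟨l, j⟩
    have hR : (Φ * D) (k, i) (l, j) =
        ZMod.stdAddChar (k * l) * symbolMatrix H S (ZMod.stdAddChar l) i j := by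
      rw [Matrix.mul_apply, Fintype.sum_prod_type]
      simp [Φ, D, Matrix.one_apply, Matrix.blockDiagonal_apply]
    have hL : ((generalizedLaplacian G fun v => (deg G v : ℂ) + 1) * Φ) (k, i) (l, j) =
        ∑ m, (generalizedLaplacian G fun v => (deg G v : ℂ) + 1) (k, i) (m, j) *
          ZMod.stdAddChar (m * l) := by
      rw [Matrix.mul_apply, Fintype.sum_prod_type]
      simp [Φ, Matrix.one_apply]
    have hpow : ∀ s : ℕ, (ZMod.stdAddChar l : ℂ) ^ s = ZMod.stdAddChar ((s : ZMod n) * l) := by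
      intro s
      rw [← AddChar.map_nsmul_eq_pow, nsmul_eq_mul]
    have hpow' : ∀ s : ℕ, (ZMod.stdAddChar l : ℂ)⁻¹ ^ s =
        ZMod.stdAddChar (-((s : ZMod n) * l)) := by
      intro s
      rw [inv_pow, hpow, AddChar.map_neg_eq_inv]
    rw [hL, hR]
    simp only [symbolMatrix, generalizedLaplacian, adjMatrix, Matrix.sub_apply, Matrix.of_apply,
      Matrix.diagonal_apply, G, edgeMult_circulantFoliation hV hE hS,
      deg_circulantFoliation hV hE hS, hpow, hpow', Prod.mk.injEq]
    push_cast
    simp only [sub_mul, add_mul, Finset.sum_sub_distrib, Finset.sum_add_distrib, ite_mul, zero_mul,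
      Finset.sum_ite_eq, Finset.mem_univ, if_true, mul_sub]
    rcases eq_or_ne i j with rfl | hij
    · simp only [and_true, if_true, Finset.sum_mul, Finset.sum_ite_eq, Finset.mem_univ, ite_mul,
        zero_mul, one_mul, mul_sub, mul_add, Finset.mul_sum, ← AddChar.map_add_eq_mul]
      rw [Finset.sum_add_distrib, Finset.sum_comm, Finset.sum_comm (s := Finset.univ) (t := S i)]
      simp only [Finset.sum_ite_eq', Finset.mem_univ, if_true, add_mul, sub_mul]
      have e1 : ∀ s : ℕ, k * l + -((s : ZMod n) * l) = k * l - s * l := fun s => by ring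
      simp only [e1]
      ring
    · simp [hij]
      ring
  have := congrArg Matrix.det hcomm
  rw [Matrix.det_mul, Matrix.det_mul, mul_comm] at this
  rw [hM, ← hD]
  exact mul_left_cancel₀ hΦ this

end Fourier

end Foliation

/-! ### Products over roots of unity and the Mahler measure -/

namespace Foliation

universe u v

lemma prod_sub_stdAddChar {n : ℕ} [NeZero n] (a : ℂ) :
    ∏ l : ZMod n, (a - ZMod.stdAddChar l) = a ^ n - 1 := by
  have hprim : IsPrimitiveRoot (ZMod.stdAddChar (1 : ZMod n)) n := by
    have := Complex.isPrimitiveRoot_exp n (NeZero.ne n)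
    convert this using 1
    have := ZMod.stdAddChar_coe (N := n) 1
    simpa using this
  have h := Polynomial.X_pow_sub_one_eq_prod (NeZero.pos n) hprim
  have h2 := congrArg (Polynomial.eval a) h
  simp only [Polynomial.eval_sub, Polynomial.eval_pow, Polynomial.eval_X, Polynomial.eval_one,
    Polynomial.eval_prod, Polynomial.eval_C] at h2
  rw [h2]
  have himg : Polynomial.nthRootsFinset n (1 : ℂ) =
      Finset.univ.image (fun l : ZMod n => ZMod.stdAddChar l) := by
    symm
    refine Finset.eq_of_subset_of_card_le ?_ ?_
    · intro x hx
      simp only [Finset.mem_image, Finset.mem_univ, true_and] at hx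
      obtain ⟨l, rfl⟩ := hx
      rw [Polynomial.mem_nthRootsFinset (NeZero.pos n), ← AddChar.map_nsmul_eq_pow]
      simp
    · rw [hprim.card_nthRootsFinset, Finset.card_image_of_injective _ ZMod.injective_stdAddChar]
      simp
  rw [himg, Finset.prod_image fun x _ y _ h => ZMod.injective_stdAddChar h]

/-- Factor p into linear terms, exchange the two products and use ∏ (a - ζ) = a^n - 1. Taking norms
disposes of the signs. -/
lemma norm_prod_eval_stdAddChar {n : ℕ} [NeZero n] (p : ℂ[X]) :
    ‖∏ l : ZMod n, p.eval (ZMod.stdAddChar l)‖ =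
      ‖p.leadingCoeff‖ ^ n * (p.roots.map fun a => ‖a ^ n - 1‖).prod := by
  have hnorm : ∀ s : Multiset ℂ, ‖s.prod‖ = (s.map norm).prod := fun s =>
    map_multiset_prod (normHom : ℂ →*₀ ℝ) s
  have h1 : ∀ z : ℂ, ‖p.eval z‖ = ‖p.leadingCoeff‖ * (p.roots.map fun a => ‖a - z‖).prod := by
    intro z
    conv_lhs => rw [(IsAlgClosed.splits p).eq_prod_roots]
    rw [Polynomial.eval_mul, Polynomial.eval_C, Polynomial.eval_multiset_prod, norm_mul,
      hnorm]
    simp [Multiset.map_map, norm_sub_rev]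
  rw [norm_prod]
  simp_rw [h1]
  rw [Finset.prod_mul_distrib, Finset.prod_const, Finset.card_univ, ZMod.card,
    ← Multiset.prod_map_prod]
  congr 2
  refine Multiset.map_congr rfl fun a _ => ?_
  rw [← prod_sub_stdAddChar, norm_prod]

lemma tendsto_norm_pow_sub_one_div {a : ℂ} (ha : ‖a‖ ≠ 1) :
    Tendsto (fun n : ℕ => ‖a ^ n - 1‖ / max 1 ‖a‖ ^ n) atTop (nhds 1) := by
  rcases lt_or_gt_of_ne ha with h | h
  · rw [max_eq_left h.le]
    have := ((tendsto_pow_atTop_nhds_zero_of_norm_lt_one h).sub_const 1).norm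
    simpa using this
  · rw [max_eq_right h.le]
    have hi : ‖a⁻¹‖ < 1 := by rw [norm_inv]; exact inv_lt_one_of_one_lt₀ h
    have := ((tendsto_pow_atTop_nhds_zero_of_norm_lt_one hi).const_sub 1).norm
    have ha0 : a ≠ 0 := by rintro rfl; simp at h; linarith
    simp only [sub_zero, norm_one] at this
    refine this.congr fun n => ?_
    rw [← norm_pow, ← norm_div, sub_div, div_self (pow_ne_zero _ ha0), inv_pow, one_div]

/-- The product of the values of a polynomial without roots on the unit circle at the `n`-th roots
of unity is asymptotic to the `n`-th power of its Mahler measure. -/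
theorem tendsto_norm_prod_eval_div {p : ℂ[X]} (hp : ∀ z : ℂ, ‖z‖ = 1 → p.eval z ≠ 0) :
    Tendsto (fun n : ℕ => ‖p.leadingCoeff‖ ^ n * (p.roots.map fun a => ‖a ^ n - 1‖).prod /
      p.mahlerMeasure ^ n) atTop (nhds 1) := by
  have hp0 : p ≠ 0 := by rintro rfl; exact hp 1 (by simp) (by simp)
  have h1 : ∀ n : ℕ, ‖p.leadingCoeff‖ ^ n * (p.roots.map fun a => ‖a ^ n - 1‖).prod /
      p.mahlerMeasure ^ n = (p.roots.map fun a => ‖a ^ n - 1‖ / max 1 ‖a‖ ^ n).prod := by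
    intro n
    -- Jensen's formula: the leading coefficients cancel and the quotient splits into one factor per
    -- root.
    rw [Polynomial.mahlerMeasure_eq_leadingCoeff_mul_prod_roots, mul_pow, mul_div_mul_left,
      Multiset.prod_map_div, Multiset.prod_map_pow]
    exact pow_ne_zero _ (norm_ne_zero_iff.2 (Polynomial.leadingCoeff_ne_zero.2 hp0))
  simp_rw [h1]
  have := tendsto_multiset_prod (x := atTop) (f := fun (a : ℂ) (n : ℕ) =>
    ‖a ^ n - 1‖ / max 1 ‖a‖ ^ n) (a := fun _ => 1) p.roots fun a ha =>
      tendsto_norm_pow_sub_one_div fun h => hp a h (Polynomial.isRoot_of_mem_roots ha)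
  simpa using this

end Foliation

/-! ### Chebyshev substitution, nonvanishing on the circle, and the asymptotics -/

namespace Foliation

universe u v

/-- Both sides satisfy u_{n+2} = (z + z⁻¹) u_{n+1} - u_n. -/
lemma two_mul_eval_chebyshevT (z : ℂ) (hz : z ≠ 0) (n : ℕ) :
    2 * (Polynomial.Chebyshev.T ℂ n).eval ((z + z⁻¹) / 2) = z ^ n + z⁻¹ ^ n := by
  induction n using Nat.twoStepInduction with
  | zero => simp; norm_num
  | one => simp; ring
  | more n h1 h2 =>
    push_cast at h1 h2 ⊢
    rw [Polynomial.Chebyshev.T_add_two]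
    simp only [Polynomial.eval_sub, Polynomial.eval_mul, Polynomial.eval_ofNat, Polynomial.eval_X]
    have h3 : z * z⁻¹ = 1 := mul_inv_cancel₀ hz
    linear_combination (z + z⁻¹) * h2 - h1 + (z ^ n + z⁻¹ ^ n) * h3

variable {V : Type u} {E : Type v} [Fintype V] [DecidableEq V] (H : Graph V E) (S : V → Finset ℕ)

lemma aeval_polyQ (z : ℂ) (hz : z ≠ 0) :
    (polyQ H S).aeval ((z + z⁻¹) / 2) = (symbolMatrix H S z).det := by
  rw [polyQ, ← AlgHom.coe_toRingHom, map_det_generalizedLaplacian, symbolMatrix]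
  congr 2
  ext i
  have h2 : (Polynomial.aeval ((z + z⁻¹) / 2) : ℤ[X] →ₐ[ℤ] ℂ) 2 = 2 := map_ofNat _ 2
  simp_rw [← two_mul_eval_chebyshevT z hz]
  simp [h2]

lemma laurentEval_eq_aeval_polyQ (z : ℂˣ) : laurentEval (laurentP H S) z =
    (polyQ H S).aeval (((z : ℂ) + (z : ℂ)⁻¹) / 2) := by
  rw [laurentEval_laurentP, aeval_polyQ _ _ _ z.ne_zero]

/-- Strict diagonal dominance: Re(z^s + z^{-s}) ≤ 2 on the circle, so the real part of the diagonal
entry exceeds the sum of the off-diagonal moduli by at least 1. -/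
lemma det_symbolMatrix_ne_zero {z : ℂ} (hz : ‖z‖ = 1) : (symbolMatrix H S z).det ≠ 0 := by
  refine det_ne_zero_of_sum_row_lt_diag fun k => ?_
  have h1 : ∑ j ∈ Finset.univ.erase k, ‖symbolMatrix H S z k j‖ =
      ∑ j ∈ Finset.univ.erase k, (edgeMult H k j : ℝ) := by
    refine Finset.sum_congr rfl fun j hj => ?_
    have : k ≠ j := (Finset.ne_of_mem_erase hj).symm
    simp [symbolMatrix, generalizedLaplacian, adjMatrix, this]
  have h2 : (deg H k : ℝ) = ∑ j ∈ Finset.univ.erase k, (edgeMult H k j : ℝ) + edgeMult H k k := by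
    rw [Finset.sum_erase_add _ _ (Finset.mem_univ k), deg, Nat.cast_sum]
  have h3 : (∑ s ∈ S k, (z ^ s + z⁻¹ ^ s)).re ≤ 2 * (S k).card := by
    rw [Complex.re_sum]
    refine (Finset.sum_le_card_nsmul _ _ 2 fun s _ => ?_).trans (by rw [nsmul_eq_mul, mul_comm])
    refine (Complex.re_le_norm _).trans ((norm_add_le _ _).trans ?_)
    simp [hz]
    norm_num
  have h4 : symbolMatrix H S z k k = 2 * ((S k).card : ℂ) + (deg H k : ℂ) + 1 -
      ∑ s ∈ S k, (z ^ s + z⁻¹ ^ s) - edgeMult H k k := by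
    simp [symbolMatrix, generalizedLaplacian, adjMatrix]
  rw [h1]
  refine lt_of_lt_of_le ?_ (Complex.re_le_norm _)
  rw [h4]
  simp only [Complex.sub_re, Complex.add_re, Complex.mul_re, Complex.natCast_re, Complex.one_re,
    Complex.natCast_im, mul_zero, sub_zero, Complex.re_ofNat]
  linarith

lemma laurentEval_laurentP_ne_zero (z : ℂˣ) (hz : ‖(z : ℂ)‖ = 1) :
    laurentEval (laurentP H S) z ≠ 0 := by
  rw [laurentEval_laurentP]
  exact det_symbolMatrix_ne_zero H S hz

lemma abs_aeval_polyQ_cos (θ : ℝ) :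
    |(polyQ H S).aeval (Real.cos θ)| = ‖(symbolMatrix H S (Circle.exp θ)).det‖ := by
  rw [← aeval_polyQ _ _ _ (Circle.coe_ne_zero _), ← Real.norm_eq_abs, ← Complex.norm_real]
  congr 1
  have h : ((Circle.exp θ : ℂ) + (Circle.exp θ : ℂ)⁻¹) / 2 = ((Real.cos θ : ℝ) : ℂ) := by
    rw [Circle.coe_exp, ← Complex.exp_neg, Complex.ofReal_cos, Complex.cos, neg_mul]
  rw [h]
  exact (Polynomial.aeval_algebraMap_apply ℂ (Real.cos θ) (polyQ H S)).symm

lemma aeval_polyQ_cos_ne_zero (θ : ℝ) : (polyQ H S).aeval (Real.cos θ) ≠ 0 := by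
  rw [← abs_ne_zero, abs_aeval_polyQ_cos, norm_ne_zero_iff]
  exact det_symbolMatrix_ne_zero H S (Circle.norm_coe _)

lemma continuous_log_abs_aeval_polyQ :
    Continuous fun t : ℝ => Real.log |(polyQ H S).aeval (Real.cos (2 * Real.pi * t))| := by
  refine Continuous.log ?_ fun t => abs_ne_zero.2 (aeval_polyQ_cos_ne_zero H S _)
  fun_prop

/-- The monomial z^k has modulus 1 on the circle, so clearing denominators affects neither the
Mahler measure nor the modulus of the product over roots of unity. -/
lemma eval_map_of_toLaurent_eq {p : ℤ[X]} {k : ℤ}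
    (hp : Polynomial.toLaurent p = LaurentPolynomial.T k * laurentP H S) {z : ℂ} (hz : ‖z‖ = 1) :
    ‖(p.map (Int.castRingHom ℂ)).eval z‖ = ‖(symbolMatrix H S z).det‖ := by
  have hz0 : z ≠ 0 := by rintro rfl; simp at hz
  have h := congrArg (LaurentPolynomial.eval₂ (Int.castRingHom ℂ) (Units.mk0 z hz0)) hp
  rw [LaurentPolynomial.eval₂_toLaurent, map_mul, LaurentPolynomial.eval₂_T] at h
  have h2 := laurentEval_laurentP H S (Units.mk0 z hz0)
  rw [laurentEval] at h2
  rw [h2] at h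
  rw [Polynomial.eval_map]
  simp only [Units.val_mk0] at h
  rw [h, norm_mul]
  simp [hz]

lemma mahlerMeasure_of_toLaurent_eq {p : ℤ[X]} {k : ℤ}
    (hp : Polynomial.toLaurent p = LaurentPolynomial.T k * laurentP H S) :
    (p.map (Int.castRingHom ℂ)).mahlerMeasure = Real.exp (∫ t in (0 : ℝ)..1,
      Real.log |(polyQ H S).aeval (Real.cos (2 * Real.pi * t))|) := by
  have hp0 : p.map (Int.castRingHom ℂ) ≠ 0 := by
    intro h
    have := eval_map_of_toLaurent_eq H S hp (z := 1) (by simp)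
    rw [h, Polynomial.eval_zero, norm_zero, eq_comm, norm_eq_zero] at this
    exact det_symbolMatrix_ne_zero H S (by simp) this
  rw [Polynomial.mahlerMeasure_def_of_ne_zero hp0]
  congr 1
  have h1 : ∀ θ : ℝ, Real.log ‖(p.map (Int.castRingHom ℂ)).eval (circleMap 0 1 θ)‖ =
      Real.log |(polyQ H S).aeval (Real.cos θ)| := by
    intro θ
    rw [abs_aeval_polyQ_cos, eval_map_of_toLaurent_eq H S hp (by simp)]
    simp [circleMap_zero, Circle.coe_exp]
  simp_rw [h1]
  -- Substitute θ = 2πt; the Jacobian cancels the normalisation 1/(2π) in the Mahler measure.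
  have h2 := intervalIntegral.mul_integral_comp_mul_left (a := 0) (b := 1)
    (f := fun θ => Real.log |(polyQ H S).aeval (Real.cos θ)|) (2 * Real.pi)
  rw [mul_zero, mul_one] at h2
  rw [← h2, inv_mul_cancel_left₀ (by positivity)]

lemma laurentMahlerMeasure_laurentP :
    laurentMahlerMeasure (laurentP H S) = Real.exp (∫ t in (0 : ℝ)..1,
      Real.log |(polyQ H S).aeval (Real.cos (2 * Real.pi * t))|) := by
  have h0 : laurentP H S ≠ 0 := by
    intro h
    refine laurentEval_laurentP_ne_zero H S 1 (by simp) ?_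
    rw [h, laurentEval, map_zero]
  rw [laurentMahlerMeasure, if_neg h0]
  simp_rw [laurentEval_laurentP, abs_aeval_polyQ_cos]
  rfl

lemma isEquivalent_numRootedSpanningForests (hV : V(H) = Set.univ) (hE : E(H).Finite)
    (hS : ∀ i, ∀ s ∈ S i, 1 ≤ s) :
    IsEquivalent atTop
      (fun n : ℕ => (numRootedSpanningForests (circulantFoliation H S n) : ℝ))
      (fun n : ℕ => Real.exp (∫ t in (0 : ℝ)..1,
        Real.log |(polyQ H S).aeval (Real.cos (2 * Real.pi * t))|) ^ n) := by
  obtain ⟨m, p, hp⟩ := (laurentP H S).exists_T_pow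
  rw [mul_comm] at hp
  rw [← mahlerMeasure_of_toLaurent_eq H S hp]
  set P := p.map (Int.castRingHom ℂ)
  have hPz : ∀ z : ℂ, ‖z‖ = 1 → P.eval z ≠ 0 := fun z hz => by
    rw [← norm_ne_zero_iff, eval_map_of_toLaurent_eq H S hp hz, norm_ne_zero_iff]
    exact det_symbolMatrix_ne_zero H S hz
  refine isEquivalent_of_tendsto_one ((tendsto_norm_prod_eval_div hPz).congr' ?_)
  -- The sum of all jumps is a convenient bound for each of them: beyond it 0 < s < n, so no jump
  -- vanishes modulo n.
  filter_upwards [eventually_gt_atTop (∑ i, ∑ s ∈ S i, s)] with n hn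
  have : NeZero n := ⟨by omega⟩
  have hS' : ∀ i, ∀ s ∈ S i, (s : ZMod n) ≠ 0 := by
    intro i s hs h
    rw [ZMod.natCast_eq_zero_iff] at h
    have h1 : s ≤ ∑ s ∈ S i, s := Finset.single_le_sum (f := fun s => s) (fun _ _ => zero_le) hs
    have h2 : ∑ s ∈ S i, s ≤ ∑ i, ∑ s ∈ S i, s :=
      Finset.single_le_sum (f := fun i => ∑ s ∈ S i, s) (fun _ _ => zero_le) (Finset.mem_univ i)
    have h3 := Nat.le_of_dvd (hS i s hs) h
    omega
  have hcount := congrArg norm (numRootedSpanningForests_circulantFoliation hV hE hS')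
  rw [Pi.div_apply, ← norm_prod_eval_stdAddChar]
  congr 1
  rw [Complex.norm_natCast, norm_prod] at hcount
  rw [hcount, norm_prod]
  refine Finset.prod_congr rfl fun l _ => ?_
  exact eval_map_of_toLaurent_eq H S hp (by rw [ZMod.stdAddChar_apply, Circle.norm_coe])

end Foliation

theorem theorem3 {V : Type*} {E : Type*} [Fintype V] [DecidableEq V]
    (H : Graph V E) (hV : H.vertexSet = Set.univ) (hE : H.edgeSet.Finite) (hH : H.Loopless)
    (S : V → Finset ℕ) (hS : ∀ i, ∀ s ∈ S i, 1 ≤ s)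
    (A : ℝ)
    (hA : A = Real.exp (∫ t in (0 : ℝ)..1, Real.log
      |(Foliation.polyQ H S).aeval (Real.cos (2 * Real.pi * t))|)) :
    -- the number of rooted spanning forests of the foliation is asymptotic to `A ^ n`
    Asymptotics.IsEquivalent Filter.atTop
      (fun n : ℕ =>
        (Foliation.numRootedSpanningForests (Foliation.circulantFoliation H S n) : ℝ))
      (fun n : ℕ => A ^ n)
    -- the integral defining `A` converges
    ∧ IntervalIntegrable (fun t : ℝ => Real.log
        |(Foliation.polyQ H S).aeval (Real.cos (2 * Real.pi * t))|) MeasureTheory.volume 0 1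
    -- `P(z) = Q((z + z⁻¹) / 2)`
    ∧ (∀ z : ℂˣ, Foliation.laurentEval (Foliation.laurentP H S) z =
        (Foliation.polyQ H S).aeval (((z : ℂ) + (z : ℂ)⁻¹) / 2))
    -- `P` has no roots on the unit circle
    ∧ (∀ z : ℂˣ, ‖(z : ℂ)‖ = 1 → Foliation.laurentEval (Foliation.laurentP H S) z ≠ 0)
    -- `A` is the Mahler measure of `P`, and of every polynomial `z ^ k * P(z)`
    ∧ A = Foliation.laurentMahlerMeasure (Foliation.laurentP H S)
    ∧ (∀ (p : Polynomial ℤ) (k : ℤ),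
        Polynomial.toLaurent p = LaurentPolynomial.T k * Foliation.laurentP H S →
        A = (p.map (Int.castRingHom ℂ)).mahlerMeasure) := by

  subst hA
  exact ⟨Foliation.isEquivalent_numRootedSpanningForests H S hV hE hS,
    (Foliation.continuous_log_abs_aeval_polyQ H S).intervalIntegrable _ _,
    Foliation.laurentEval_eq_aeval_polyQ H S, Foliation.laurentEval_laurentP_ne_zero H S,
    (Foliation.laurentMahlerMeasure_laurentP H S).symm,
    fun p k hp => (Foliation.mahlerMeasure_of_toLaurent_eq H S hp).symm⟩
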